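/- Let $(\mathcal M,d)$ be a complete NPC space. That is, any two points are joined by a geodesic (a path $\gamma:[0,1]\to\mathcal M$ with $d(\gamma(s),\gamma(t))=(t-s)\,d(\gamma(0),\gamma(1))$ for $0\le s\le t\le 1$), and for every $p\in\mathcal M$, every geodesic $\gamma$ and every $t\in[0,1]$, \[d^2(p,\gamma(t))\le(1-t)\,d^2(p,\gamma(0))+t\,d^2(p,\gamma(1))-t(1-t)\,d^2(\gamma(0),\gamma(1)).\] Let $\mathcal Z$ be a set, let $\beta>0$, and let $\ell:\mathcal M\times\mathcal Z\to\mathbb R$ be a loss such that, for every $z\in\mathcal Z$, the function $\ell(\cdot,z)$ is lower semicontinuous and $e^{-\beta\ell(\cdot,z)}$ is geodesically concave, i.e. $t\mapsto e^{-\beta\ell(\gamma(t),z)}$ is concave on $[0,1]$ for every geodesic $\gamma$. Let $\Theta$ be a measurable space of experts and $\pi$ a prior probability measure on $\Theta$. Let $(z_t)_{t\ge1}$ be any sequence in $\mathcal Z$ and, for $t\ge 1$, let $\theta\mapsto m_{\theta,t}\in\mathcal M$ be any measurable expert advice. Put \[L_{\theta,T}=\sum_{t=1}^T\ell(m_{\theta,t},z_t),\qquad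 L_{\theta,0}=0,\qquad \mathrm d\pi_t(\theta)=\frac{e^{-\beta L_{\theta,t-1}}\,\mathrm d\pi(\theta)}{\int_\Theta e^{-\beta L_{\vartheta,t-1}}\,\mathrm d\pi(\vartheta)},\] and let $P_t$ be the pushforward of $\pi_t$ by $\theta\mapsto m_{\theta,t}$. Assume that for every $t\ge1$, $P_t$ is a probability measure with $\int_{\mathcal M} d^2(x,y)\,\mathrm dP_t(y)<\infty$ for all $x\in\mathcal M$. Let $\hat m_t$, $t\ge1$, be the predictions of the generalized exponentially weighted average forecaster with constant parameter $\beta$, i.e. $\hat m_t$ is the barycenter of $P_t$: \[\hat m_t\in\operatorname*{arg\,min}_{x\in\mathcal M}\int_{\mathcal M} d^2(x,y)\,\mathrm dP_t(y).\] Then for every $T\ge1$ the cumulative loss $\hat L_T=\sum_{t=1}^T\ell(\hat m_t,z_t)$ satisfies \[\hat L_T\le\inf_q\left\{\int_\Theta L_{\theta,T}\,\mathrm dq(\theta)+\frac{D(q\|\pi)}{\beta}\right\},\] where the infimum runs over all probability measures $q$ on $\Theta$, $D(q\|\pi)$ is the Kullback--Leibler divergence ($+\infty$ if $q\not\ll\pi$),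 the integral takes values in $[-\infty,+\infty]$, and the expression in braces is read as $+\infty$ when $D(q\|\pi)=+\infty$. In particular, if $\Theta$ is finite with $K$ elements (all singletons being measurable) and $\pi$ is the uniform prior, then for every $T\ge1$ \[R_T=\hat L_T-\min_{\theta\in\Theta}L_{\theta,T}\le\frac{\ln K}{\beta}.\] -/

import Mathlib

open MeasureTheory

noncomputable section

namespace EWA

/-! ### Geodesic spaces, non-positive curvature, geodesic convexity -/

section Geometry

variable {M : Type*} [MetricSpace M]

/-- `γ`, restricted to `[0,1]`, is a (constant speed, minimizing) geodesic. Continuity on `[0,1]`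
is a consequence of the defining identity. -/
def IsGeodesic (γ : ℝ → M) : Prop :=
  ∀ s t : ℝ, 0 ≤ s → s ≤ t → t ≤ 1 → dist (γ s) (γ t) = (t - s) * dist (γ 0) (γ 1)

variable (M) in
/-- Any two points are joined by a geodesic. -/
def IsGeodesicSpace : Prop :=
  ∀ x y : M, ∃ γ : ℝ → M, IsGeodesic γ ∧ γ 0 = x ∧ γ 1 = y

variable (M) in
/-- NPC space: a geodesic space with `curv ≤ 0`. Completeness is a separate class assumption. -/
structure IsNPC : Prop where
  geodesic : IsGeodesicSpace M
  curv_nonpos : ∀ (p : M) (γ : ℝ → M), IsGeodesic γ → ∀ t : ℝ, 0 ≤ t → t ≤ 1 →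
    dist p (γ t) ^ 2 ≤
      (1 - t) * dist p (γ 0) ^ 2 + t * dist p (γ 1) ^ 2 - t * (1 - t) * dist (γ 0) (γ 1) ^ 2

/-- `f` is convex along every geodesic. -/
def GeodesicallyConvex (f : M → ℝ) : Prop :=
  ∀ γ : ℝ → M, IsGeodesic γ → ConvexOn ℝ (Set.Icc 0 1) (fun t => f (γ t))

/-- `-f` is geodesically convex. -/
def GeodesicallyConcave (f : M → ℝ) : Prop :=
  GeodesicallyConvex (fun x => - f x)

/-! ### Barycenters -/

/-- Membership in `𝒫₂(M)`. -/
structure MemP2 [MeasurableSpace M] (P : Measure M) : Prop where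
  prob : IsProbabilityMeasure P
  integrable_sq_dist : ∀ x : M, Integrable (fun y => dist x y ^ 2) P

/-- `b` minimizes `x ↦ ∫ d²(x, y) dP(y)` over `M` (meaningful for `P ∈ 𝒫₂(M)`). -/
def IsBarycenter [MeasurableSpace M] (P : Measure M) (b : M) : Prop :=
  ∀ x : M, ∫ y, dist b y ^ 2 ∂P ≤ ∫ y, dist x y ^ 2 ∂P

end Geometry

/-! ### Prediction with expert advice. Rounds are `t = 1, 2, …`. -/

section Experts

variable {M Z Θ : Type*}

/-- Cumulative loss over the rounds `1, …, T` of the sequence of decisions `a`. -/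
def cumLoss (ℓ : M → Z → ℝ) (z : ℕ → Z) (a : ℕ → M) (T : ℕ) : ℝ :=
  ∑ t ∈ Finset.Icc 1 T, ℓ (a t) (z t)

/-- `L_{θ,T}`, the cumulative loss of expert `θ`, whose advice in round `t` is `m t θ`. -/
def expertLoss (ℓ : M → Z → ℝ) (z : ℕ → Z) (m : ℕ → Θ → M) (T : ℕ) (θ : Θ) : ℝ :=
  cumLoss ℓ z (fun t => m t θ) T

/-- Regret against a finite, non-empty set of experts. -/
def regret [Fintype Θ] [Nonempty Θ] (ℓ : M → Z → ℝ) (z : ℕ → Z) (m : ℕ → Θ → M)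
    (mhat : ℕ → M) (T : ℕ) : ℝ :=
  cumLoss ℓ z mhat T - Finset.univ.inf' Finset.univ_nonempty (expertLoss ℓ z m T)

variable [MeasurableSpace Θ]

/-- The exponential-weights posterior `π_t`, with density `e^{-β L_{θ,t-1}} / ∫ e^{-β L_{ϑ,t-1}} dπ`
with respect to the prior `π` (used for `t ≥ 1`). -/
def posterior (π : Measure Θ) (β : ℝ) (ℓ : M → Z → ℝ) (z : ℕ → Z) (m : ℕ → Θ → M) (t : ℕ) :
    Measure Θ :=
  π.tilted (fun θ => -(β * expertLoss ℓ z m (t - 1) θ))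

/-- `P_t`, the pushforward of the posterior `π_t` by the expert advice `θ ↦ m_{θ,t}`. -/
def adviceLaw [MeasurableSpace M] (π : Measure Θ) (β : ℝ) (ℓ : M → Z → ℝ) (z : ℕ → Z)
    (m : ℕ → Θ → M) (t : ℕ) : Measure M :=
  (posterior π β ℓ z m t).map (m t)

/-- `mhat` is the generalized exponentially weighted average forecaster with constant
parameter `β`: in each round it plays the barycenter of `P_t`. -/
def IsEWAForecaster [MetricSpace M] [MeasurableSpace M] (π : Measure Θ) (β : ℝ)
    (ℓ : M → Z → ℝ) (z : ℕ → Z) (m : ℕ → Θ → M) (mhat : ℕ → M) : Prop :=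
  ∀ t : ℕ, 1 ≤ t → IsBarycenter (adviceLaw π β ℓ z m t) (mhat t)

/-- The extended-real integral `∫ f⁺ dμ - ∫ f⁻ dμ`, equal to the usual integral when `f` is
integrable, and to `±∞` when exactly one of the two parts is infinite. -/
def extIntegral (f : Θ → ℝ) (μ : Measure Θ) : EReal :=
  ((∫⁻ θ, ENNReal.ofReal (f θ) ∂μ : ENNReal) : EReal) -
    ((∫⁻ θ, ENNReal.ofReal (-f θ) ∂μ : ENNReal) : EReal)

open Classical in
/-- `∫ L dq + D(q‖π) / β`, read as `+∞` when `D(q‖π) = +∞` (whatever the value of the integral,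
so that `-∞ + ∞` is `+∞`). -/
def pacObjective (π : Measure Θ) (β : ℝ) (L : Θ → ℝ) (q : Measure Θ) : EReal :=
  if InformationTheory.klDiv q π = ⊤ then ⊤
  else extIntegral L q + (InformationTheory.klDiv q π : EReal) / (β : EReal)

end Experts

end EWA

end

open Filter Topology

namespace EWA

/-! ### Jensen's inequality for barycenters -/

section Jensen

/-! Jensen's inequality at the barycenter gives `∫ e^{-βℓ} dP_t ≤ e^{-βℓ(m̂_t)}`. The left side is
the ratio `W_t / W_{t-1}` with `W_t = ∫ e^{-βL_{θ,t}} dπ`, so the product telescopes to `W_T ≤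
e^{-βL̂_T}`, i.e. `L̂_T ≤ -(1/β) log W_T`. Donsker–Varadhan bounds this by the objective at each
`q`; for a uniform prior, one keeps only the best expert's term in `W_T`. Jensen
(`IsBarycenter.integral_le`) comes from projecting `(b, ∫ φ dP)` onto the hypograph of `φ` in `M ×
ℝ`: integrating the obtuse angle inequality against `P` forces the point to be its own projection.
-/

/-- A closed set on which a continuous function bounded below is uniformly midpoint convex contains
a minimizer of that function. -/
theorem exists_isMinOn_of_midpoint {X : Type*} [MetricSpace X] [CompleteSpace X] {C : Set X}
    (hC : IsClosed C) (hne : C.Nonempty) {G : X → ℝ} (hG : Continuous G) (h0 : ∀ x, 0 ≤ G x)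
    (hmid : ∀ x ∈ C, ∀ y ∈ C, ∃ w ∈ C, G w ≤ G x / 2 + G y / 2 - dist x y ^ 2 / 4) :
    ∃ x ∈ C, ∀ y ∈ C, G x ≤ G y := by
  have hbdd : BddBelow (G '' C) := ⟨0, by rintro _ ⟨x, -, rfl⟩; exact h0 x⟩
  set I := sInf (G '' C) with hI
  have hle : ∀ y ∈ C, I ≤ G y := fun y hy => csInf_le hbdd ⟨y, hy, rfl⟩
  have hseq : ∀ n : ℕ, ∃ x ∈ C, G x < I + 1 / ((n : ℝ) + 1) := by
    intro n
    obtain ⟨_, ⟨x, hx, rfl⟩, hlt⟩ := exists_lt_of_csInf_lt (hne.image G)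
      (lt_add_of_pos_right I (Nat.one_div_pos_of_nat (n := n) (α := ℝ)))
    exact ⟨x, hx, hlt⟩
  choose u huC hu using hseq
  -- The value at the midpoint is at least `I`, so near-minimizers are close together.
  have hdist : ∀ n k : ℕ, dist (u n) (u k) ^ 2 ≤
      2 * (1 / ((n : ℝ) + 1)) + 2 * (1 / ((k : ℝ) + 1)) := by
    intro n k
    obtain ⟨w, hw, hGw⟩ := hmid _ (huC n) _ (huC k)
    linarith [hle w hw, hu n, hu k]
  have hcau : CauchySeq u := by
    refine cauchySeq_of_le_tendsto_0 (fun N : ℕ => Real.sqrt (4 * (1 / ((N : ℝ) + 1)))) ?_ ?_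
    · intro n k N hn hk
      refine Real.le_sqrt_of_sq_le ((hdist n k).trans ?_)
      linarith [Nat.one_div_le_one_div (α := ℝ) hn, Nat.one_div_le_one_div (α := ℝ) hk]
    · simpa using ((tendsto_one_div_add_atTop_nhds_zero_nat (𝕜 := ℝ)).const_mul 4).sqrt
  obtain ⟨x, hx⟩ := cauchySeq_tendsto_of_complete hcau
  refine ⟨x, hC.mem_of_tendsto hx (Eventually.of_forall huC), fun y hy => ?_⟩
  have h1 : Tendsto (fun n => G (u n)) atTop (𝓝 (G x)) := (hG.tendsto x).comp hx
  have h2 : Tendsto (fun n : ℕ => I + 1 / ((n : ℝ) + 1)) atTop (𝓝 (I + 0)) :=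
    tendsto_const_nhds.add tendsto_one_div_add_atTop_nhds_zero_nat
  have h3 := le_of_tendsto_of_tendsto' h1 h2 (fun n => (hu n).le)
  linarith [hle y hy]

variable {M : Type*} [MetricSpace M]

theorem GeodesicallyConcave.le_apply {φ : M → ℝ} (hφ : GeodesicallyConcave φ) {γ : ℝ → M}
    (hγ : IsGeodesic γ) {t : ℝ} (ht0 : 0 ≤ t) (ht1 : t ≤ 1) :
    (1 - t) * φ (γ 0) + t * φ (γ 1) ≤ φ (γ t) := by
  have h := (hφ γ hγ).2 (Set.left_mem_Icc.2 zero_le_one) (Set.right_mem_Icc.2 zero_le_one)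
    (sub_nonneg.2 ht1) ht0 (sub_add_cancel 1 t)
  simp only [smul_eq_mul, mul_zero, mul_one, zero_add] at h
  linarith

/-- Projection of the point `(b, I)` onto the hypograph of a concave function, together with the
obtuse angle inequality. -/
theorem IsNPC.exists_proj_hypograph [CompleteSpace M] (hM : IsNPC M) {φ : M → ℝ}
    (husc : UpperSemicontinuous φ) (hφ : GeodesicallyConcave φ) (b : M) (I : ℝ) :
    ∃ x r, r ≤ φ x ∧ ∀ y s, s ≤ φ y →
      dist b x ^ 2 + (r - I) ^ 2 + (dist x y ^ 2 + (r - s) ^ 2) ≤ dist b y ^ 2 + (s - I) ^ 2 := by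
  set C : Set (M × ℝ) := {p | p.2 ≤ φ p.1} with hCdef
  set G : M × ℝ → ℝ := fun p => dist b p.1 ^ 2 + (p.2 - I) ^ 2 with hGdef
  have hC : IsClosed C := upperSemicontinuous_iff_IsClosed_hypograph.1 husc
  -- Strong convexity of `G` for the ℓ² product structure; concavity of `φ` keeps the product path
  -- in `C`.
  have hpath : ∀ p ∈ C, ∀ q ∈ C, ∀ t : ℝ, 0 ≤ t → t ≤ 1 → ∃ w ∈ C,
      G w ≤ (1 - t) * G p + t * G q - t * (1 - t) * (dist p.1 q.1 ^ 2 + (p.2 - q.2) ^ 2) := by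
    rintro ⟨x, r⟩ hp ⟨y, s⟩ hq t ht0 ht1
    obtain ⟨γ, hγ, rfl, rfl⟩ := hM.geodesic x y
    simp only [hCdef, Set.mem_ofPred_eq] at hp hq
    refine ⟨(γ t, (1 - t) * r + t * s), ?_, ?_⟩
    · simp only [hCdef, Set.mem_ofPred_eq]
      have h1 := hφ.le_apply hγ ht0 ht1
      have h2 := mul_le_mul_of_nonneg_left hp (sub_nonneg.2 ht1)
      have h3 := mul_le_mul_of_nonneg_left hq ht0
      linarith
    · have h1 := hM.curv_nonpos b γ hγ t ht0 ht1
      simp only [hGdef]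
      linear_combination h1
  obtain ⟨⟨x, r⟩, hxC, hmin⟩ := exists_isMinOn_of_midpoint hC ⟨(b, φ b), le_refl (φ b)⟩
    (G := G) (by fun_prop) (fun p => by positivity) (by
      intro p hp q hq
      obtain ⟨w, hw, h⟩ := hpath p hp q hq (1 / 2) (by norm_num) (by norm_num)
      refine ⟨w, hw, h.trans ?_⟩
      -- `dist` on `M × ℝ` is the sup metric, which the ℓ² distance dominates.
      have hd : dist p q ^ 2 ≤ dist p.1 q.1 ^ 2 + (p.2 - q.2) ^ 2 := by
        rw [Prod.dist_eq, ← sq_abs (p.2 - q.2), ← Real.dist_eq]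
        rcases max_choice (dist p.1 q.1) (dist p.2 q.2) with h | h <;> rw [h] <;>
          nlinarith [sq_nonneg (dist p.1 q.1), sq_nonneg (dist p.2 q.2)]
      linarith)
  refine ⟨x, r, hxC, fun y s hs => ?_⟩
  set D := dist x y ^ 2 + (r - s) ^ 2 with hD
  -- Minimality against the path towards `(y, s)`, divided by `t`; then `t → 0`.
  have key : ∀ t ∈ Set.Ioc (0 : ℝ) 1, G (x, r) + (1 - t) * D ≤ G (y, s) := by
    rintro t ⟨ht0, ht1⟩
    obtain ⟨w, hw, h⟩ := hpath (x, r) hxC (y, s) hs t ht0.le ht1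
    have h2 := hmin w hw
    refine le_of_mul_le_mul_left ?_ ht0
    simp only [← hD] at h
    linarith
  have hlim : Tendsto (fun t : ℝ => G (x, r) + (1 - t) * D) (𝓝[>] 0)
      (𝓝 (G (x, r) + (1 - 0) * D)) :=
    (Continuous.tendsto (by fun_prop) 0).mono_left nhdsWithin_le_nhds
  have hfin := le_of_tendsto hlim (by
    filter_upwards [Ioc_mem_nhdsGT (zero_lt_one' ℝ)] with t ht using key t ht)
  simpa using hfin

/-- Jensen's inequality for barycenters in complete NPC spaces. -/
theorem IsBarycenter.integral_le [CompleteSpace M] [MeasurableSpace M] (hM : IsNPC M)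
    {P : Measure M} (hP : MemP2 P) {b : M} (hb : IsBarycenter P b) {φ : M → ℝ}
    (husc : UpperSemicontinuous φ) (hφ : GeodesicallyConcave φ) (hint : Integrable φ P) :
    ∫ y, φ y ∂P ≤ φ b := by
  have := hP.prob
  set I := ∫ y, φ y ∂P with hI
  obtain ⟨x, r, hr, hproj⟩ := hM.exists_proj_hypograph husc hφ b I
  -- The terms `φ y ^ 2` cancel, so integrability of `φ` suffices.
  have hpt : ∀ y, dist x y ^ 2 + (dist b x ^ 2 + (r - I) ^ 2 + (r ^ 2 - I ^ 2)) ≤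
      dist b y ^ 2 + 2 * (r - I) * φ y := by
    intro y
    linear_combination hproj y (φ y) le_rfl
  have hmono := integral_mono ((hP.integrable_sq_dist x).add (integrable_const _))
    ((hP.integrable_sq_dist b).add (hint.const_mul (2 * (r - I)))) hpt
  simp only [Pi.add_apply] at hmono
  rw [integral_add (hP.integrable_sq_dist x) (integrable_const _),
    integral_add (hP.integrable_sq_dist b) (hint.const_mul _), integral_const_mul, ← hI] at hmono
  simp only [integral_const, probReal_univ, one_smul] at hmono
  have hbx := hb x
  have hz : dist b x ^ 2 + 2 * (r - I) ^ 2 ≤ 0 := by linear_combination hmono + hbx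
  have h1 : dist b x = 0 := by
    refine pow_eq_zero_iff two_ne_zero |>.1 (le_antisymm ?_ (sq_nonneg _))
    linarith [sq_nonneg (r - I)]
  have h2 : r - I = 0 := by
    refine pow_eq_zero_iff two_ne_zero |>.1 (le_antisymm ?_ (sq_nonneg _))
    linarith [sq_nonneg (dist b x)]
  rw [dist_eq_zero] at h1
  rw [h1]
  linarith

end Jensen

/-! ### The Donsker–Varadhan inequality -/

section DonskerVaradhan

variable {Θ : Type*} [MeasurableSpace Θ] {q π : Measure Θ}

/-- Fenchel–Young inequality for the conjugate pair `x log x - x` and `exp`. -/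
theorem mul_le_mul_log_sub_add_exp {r : ℝ} (hr : 0 ≤ r) (a : ℝ) :
    r * a ≤ r * Real.log r - r + Real.exp a := by
  rcases hr.eq_or_lt with rfl | hr
  · simpa using (Real.exp_pos a).le
  · have h := Real.log_le_sub_one_of_pos (div_pos (Real.exp_pos a) hr)
    rw [Real.log_div (Real.exp_pos a).ne' hr.ne', Real.log_exp] at h
    have h2 := mul_le_mul_of_nonneg_left h hr.le
    rw [mul_sub, mul_sub, mul_div_cancel₀ _ hr.ne'] at h2
    linarith

/-- If `exp f` is `π`-integrable and `q` has finite entropy relative to `π`, then `f⁺` is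
`q`-integrable. -/
theorem integrable_posPart_of_integrable_exp [IsFiniteMeasure q] [IsFiniteMeasure π]
    (hac : q ≪ π) (hllr : Integrable (llr q π) q) {f : Θ → ℝ} (hf : Measurable f)
    (hexp : Integrable (fun θ => Real.exp (f θ)) π) :
    Integrable (fun θ => max (f θ) 0) q := by
  rw [← integrable_rnDeriv_smul_iff hac]
  rw [← integrable_rnDeriv_mul_log_iff hac] at hllr
  refine ((hllr.abs.add (integrable_const 1)).add hexp).mono' ?_ (Eventually.of_forall fun θ => ?_)
  · exact ((Measure.measurable_rnDeriv q π).ennreal_toReal.mul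
      (hf.max measurable_const)).aestronglyMeasurable
  · set r := (q.rnDeriv π θ).toReal
    have hr : 0 ≤ r := ENNReal.toReal_nonneg
    have h1 := mul_le_mul_log_sub_add_exp hr (max (f θ) 0)
    have h2 : Real.exp (max (f θ) 0) ≤ 1 + Real.exp (f θ) := by
      rcases max_choice (f θ) 0 with h | h <;> rw [h]
      · linarith
      · simpa using (Real.exp_pos (f θ)).le
    rw [smul_eq_mul, Real.norm_of_nonneg (mul_nonneg hr (le_max_right _ _))]
    simp only [Pi.add_apply]
    linarith [le_abs_self (r * Real.log r)]

/-- The easy half of the Donsker–Varadhan variational formula. -/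
theorem integral_le_klDiv_add_log [IsProbabilityMeasure q] [IsProbabilityMeasure π]
    (hac : q ≪ π) (hllr : Integrable (llr q π) q) {f : Θ → ℝ} (hf : Integrable f q)
    (hexp : Integrable (fun θ => Real.exp (f θ)) π) :
    ∫ θ, f θ ∂q ≤
      (InformationTheory.klDiv q π).toReal + Real.log (∫ θ, Real.exp (f θ) ∂π) := by
  -- The claim is nonnegativity of the divergence of `q` from the tilted measure `π.tilted f`.
  have := isProbabilityMeasure_tilted hexp
  have h1 := integral_llr_tilted_right hac hf hexp hllr
  have h2 := InformationTheory.integral_llr_add_sub_measure_univ_nonneg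
    (hac.trans (absolutelyContinuous_tilted hexp))
    (integrable_llr_tilted_right hac hf hllr hexp)
  rw [InformationTheory.toReal_klDiv_of_measure_eq hac (by simp)]
  simp only [probReal_univ] at h2
  linarith

theorem extIntegral_eq_integral {f : Θ → ℝ} (hf : Integrable f q) :
    extIntegral f q = ((∫ θ, f θ ∂q : ℝ) : EReal) := by
  have h1 : ∫⁻ θ, ENNReal.ofReal (f θ) ∂q ≠ ⊤ := hf.lintegral_lt_top.ne
  have h2 : ∫⁻ θ, ENNReal.ofReal (-f θ) ∂q ≠ ⊤ := hf.neg.lintegral_lt_top.ne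
  rw [integral_eq_lintegral_pos_part_sub_lintegral_neg_part hf, EReal.coe_sub, extIntegral,
    EReal.coe_ennreal_toReal h1, EReal.coe_ennreal_toReal h2]

/-- An extended-real form of the Donsker–Varadhan inequality. -/
theorem neg_log_integral_exp_le_pacObjective [IsProbabilityMeasure q] [IsProbabilityMeasure π]
    {β : ℝ} (hβ : 0 < β) {L : Θ → ℝ} (hL : Measurable L)
    (hexp : Integrable (fun θ => Real.exp (-(β * L θ))) π) :
    ((-Real.log (∫ θ, Real.exp (-(β * L θ)) ∂π) / β : ℝ) : EReal) ≤ pacObjective π β L q := by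
  unfold pacObjective
  split_ifs with hkl
  · exact le_top
  obtain ⟨hac, hllr⟩ := InformationTheory.klDiv_ne_top_iff.1 hkl
  have hD : (InformationTheory.klDiv q π : EReal) / (β : EReal) =
      (((InformationTheory.klDiv q π).toReal / β : ℝ) : EReal) := by
    rw [EReal.coe_div, EReal.coe_ennreal_toReal hkl]
  rw [hD]
  -- Finite entropy rules out an infinite negative part, so a non-integrable `L` has integral `+∞`.
  have hneg : Integrable (fun θ => max (-(L θ)) 0) q := by
    have h := integrable_posPart_of_integrable_exp hac hllr (hL.const_mul β).neg hexp
    refine (h.const_mul β⁻¹).congr (Eventually.of_forall fun θ => ?_)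
    simp only [Pi.neg_apply]
    rw [mul_max_of_nonneg _ _ (inv_nonneg.2 hβ.le)]
    congr 1
    · field_simp
    · simp
  by_cases hint : Integrable L q
  · rw [extIntegral_eq_integral hint, ← EReal.coe_add, EReal.coe_le_coe_iff]
    have h := integral_le_klDiv_add_log hac hllr (hint.const_mul β).neg hexp
    simp only [Pi.neg_apply] at h
    rw [integral_neg, integral_const_mul] at h
    rw [div_le_iff₀ hβ, add_mul, div_mul_cancel₀ _ hβ.ne']
    linarith
  · have h2 : ∫⁻ θ, ENNReal.ofReal (-L θ) ∂q ≠ ⊤ := by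
      have h := hneg.lintegral_lt_top.ne
      simpa [ENNReal.ofReal_max] using h
    have h1 : ∫⁻ θ, ENNReal.ofReal (L θ) ∂q = ⊤ := by
      by_contra h1
      refine hint ⟨hL.aestronglyMeasurable, ?_⟩
      rw [hasFiniteIntegral_iff_norm]
      have hle : ∀ θ, ENNReal.ofReal ‖L θ‖ ≤ ENNReal.ofReal (L θ) + ENNReal.ofReal (-L θ) := by
        intro θ
        rcases le_total 0 (L θ) with h | h
        · rw [Real.norm_of_nonneg h]; exact le_self_add
        · rw [Real.norm_of_nonpos h]; exact le_add_self
      refine (lintegral_mono hle).trans_lt ?_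
      rw [lintegral_add_left hL.ennreal_ofReal]
      exact ENNReal.add_lt_top.2 ⟨lt_top_iff_ne_top.2 h1, lt_top_iff_ne_top.2 h2⟩
    have htop : extIntegral L q = ⊤ := by
      rw [extIntegral, h1, ← EReal.coe_ennreal_toReal h2, EReal.coe_ennreal_top,
        EReal.top_sub_coe]
    rw [htop, EReal.top_add_coe]
    exact le_top

end DonskerVaradhan

/-! ### Telescoping of the exponential weights -/

section Forecaster

variable {M Z Θ : Type*}

theorem cumLoss_zero (ℓ : M → Z → ℝ) (z : ℕ → Z) (a : ℕ → M) : cumLoss ℓ z a 0 = 0 := by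
  simp [cumLoss]

theorem cumLoss_succ (ℓ : M → Z → ℝ) (z : ℕ → Z) (a : ℕ → M) (T : ℕ) :
    cumLoss ℓ z a (T + 1) = cumLoss ℓ z a T + ℓ (a (T + 1)) (z (T + 1)) := by
  rw [cumLoss, Finset.sum_Icc_succ_top (by omega), cumLoss]

variable [MetricSpace M] [MeasurableSpace M] [MeasurableSpace Θ]

theorem measurable_expertLoss [BorelSpace M] {ℓ : M → Z → ℝ}
    (hlsc : ∀ z : Z, LowerSemicontinuous (fun x => ℓ x z)) (z : ℕ → Z) {m : ℕ → Θ → M}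
    (hmeas : ∀ t : ℕ, 1 ≤ t → Measurable (m t)) (T : ℕ) : Measurable (expertLoss ℓ z m T) := by
  unfold expertLoss cumLoss
  refine Finset.measurable_fun_sum _ fun t ht => ?_
  exact (hlsc (z t)).measurable.comp (hmeas t (Finset.mem_Icc.1 ht).1)

/-- Were this false, `tilted` would take its default value `0`, and the law of round `T + 1`, whose
weights use `L_{θ,T}`, would not be a probability measure. -/
theorem integrable_exp_expertLoss {π : Measure Θ} {β : ℝ} {ℓ : M → Z → ℝ} {z : ℕ → Z}
    {m : ℕ → Θ → M} (hP2 : ∀ t : ℕ, 1 ≤ t → MemP2 (adviceLaw π β ℓ z m t)) (T : ℕ) :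
    Integrable (fun θ => Real.exp (-(β * expertLoss ℓ z m T θ))) π := by
  by_contra h
  have hp := (hP2 (T + 1) (by omega)).prob
  rw [adviceLaw, posterior, Nat.add_sub_cancel, tilted_of_not_integrable h, Measure.map_zero] at hp
  exact hp.ne_zero _ rfl

/-- The cumulative exponential gain of the forecaster dominates the mixture of those of the
experts. -/
theorem IsEWAForecaster.integral_exp_expertLoss_le [BorelSpace M] [CompleteSpace M]
    (hM : IsNPC M)
    {ℓ : M → Z → ℝ} (hlsc : ∀ z : Z, LowerSemicontinuous (fun x => ℓ x z))
    {β : ℝ} (hβ : 0 < β)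
    (hconc : ∀ z : Z, GeodesicallyConcave (fun x => Real.exp (-(β * ℓ x z))))
    {π : Measure Θ} [IsProbabilityMeasure π] {z : ℕ → Z} {m : ℕ → Θ → M}
    (hmeas : ∀ t : ℕ, 1 ≤ t → Measurable (m t))
    (hP2 : ∀ t : ℕ, 1 ≤ t → MemP2 (adviceLaw π β ℓ z m t))
    {mhat : ℕ → M} (hmhat : IsEWAForecaster π β ℓ z m mhat) (T : ℕ) :
    ∫ θ, Real.exp (-(β * expertLoss ℓ z m T θ)) ∂π ≤
      Real.exp (-(β * cumLoss ℓ z mhat T)) := by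
  induction T with
  | zero => simp [expertLoss, cumLoss_zero]
  | succ T ih =>
    set φ : M → ℝ := fun x => Real.exp (-(β * ℓ x (z (T + 1)))) with hφ
    have husc : UpperSemicontinuous φ :=
      Continuous.comp_lowerSemicontinuous_antitone (g := fun s : ℝ => Real.exp (-(β * s)))
        (by fun_prop) (hlsc (z (T + 1)))
        (fun a b hab => Real.exp_le_exp.2 (neg_le_neg (mul_le_mul_of_nonneg_left hab hβ.le)))
    have hm := hmeas (T + 1) (by omega)
    have hI := integrable_exp_expertLoss hP2 T
    have hstep : ∀ θ, Real.exp (-(β * expertLoss ℓ z m (T + 1) θ)) =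
        Real.exp (-(β * expertLoss ℓ z m T θ)) * φ (m (T + 1) θ) := by
      intro θ
      rw [hφ, ← Real.exp_add, expertLoss, cumLoss_succ, expertLoss]
      ring_nf
    have hlaw : adviceLaw π β ℓ z m (T + 1) =
        (π.tilted fun θ => -(β * expertLoss ℓ z m T θ)).map (m (T + 1)) := rfl
    have hφint : Integrable φ (adviceLaw π β ℓ z m (T + 1)) := by
      rw [hlaw, integrable_map_measure husc.measurable.aestronglyMeasurable hm.aemeasurable,
        integrable_tilted_iff hI]
      exact (integrable_exp_expertLoss hP2 (T + 1)).congr (Eventually.of_forall hstep)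
    have hjensen := (hmhat (T + 1) (by omega)).integral_le hM (hP2 (T + 1) (by omega)) husc
      (hconc _) hφint
    rw [hlaw, integral_map hm.aemeasurable husc.measurable.aestronglyMeasurable,
      integral_tilted] at hjensen
    have hpos := integral_exp_pos hI
    set W := ∫ θ, Real.exp (-(β * expertLoss ℓ z m T θ)) ∂π with hW
    -- `W_{T+1} = W_T ∫ φ dP_{T+1}`, the telescoping identity.
    have hW1 : ∫ θ, Real.exp (-(β * expertLoss ℓ z m (T + 1) θ)) ∂π =
        W * ∫ θ, (Real.exp (-(β * expertLoss ℓ z m T θ)) / W) • φ (m (T + 1) θ) ∂π := by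
      rw [← integral_const_mul]
      refine integral_congr_ae (Eventually.of_forall fun θ => ?_)
      simp only [hstep, smul_eq_mul]
      field_simp
    rw [hW1, cumLoss_succ, mul_add, neg_add, Real.exp_add]
    exact mul_le_mul ih hjensen (integral_nonneg fun θ => by positivity) (Real.exp_pos _).le

end Forecaster

end EWA

theorem mainTheorem1
    {M Z Θ : Type*} [MetricSpace M] [CompleteSpace M] [MeasurableSpace M] [BorelSpace M]
    [MeasurableSpace Θ]
    (hM : EWA.IsNPC M)
    (ℓ : M → Z → ℝ) (hlsc : ∀ z : Z, LowerSemicontinuous (fun x => ℓ x z))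
    (β : ℝ) (hβ : 0 < β)
    (hconc : ∀ z : Z, EWA.GeodesicallyConcave (fun x => Real.exp (-(β * ℓ x z))))
    (π : Measure Θ) [IsProbabilityMeasure π]
    (z : ℕ → Z) (m : ℕ → Θ → M)
    (hmeas : ∀ t : ℕ, 1 ≤ t → Measurable (m t))
    (hP2 : ∀ t : ℕ, 1 ≤ t → EWA.MemP2 (EWA.adviceLaw π β ℓ z m t))
    (mhat : ℕ → M) (hmhat : EWA.IsEWAForecaster π β ℓ z m mhat) :
    (∀ T : ℕ, 1 ≤ T →
      ((EWA.cumLoss ℓ z mhat T : ℝ) : EReal) ≤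
        ⨅ q : ProbabilityMeasure Θ,
          EWA.pacObjective π β (EWA.expertLoss ℓ z m T) (q : Measure Θ)) ∧
    (∀ [Fintype Θ] [Nonempty Θ] [MeasurableSingletonClass Θ],
      π = ProbabilityTheory.uniformOn Set.univ →
      ∀ T : ℕ, 1 ≤ T →
        EWA.regret ℓ z m mhat T ≤ Real.log (Fintype.card Θ) / β) := by
  have hmain := EWA.IsEWAForecaster.integral_exp_expertLoss_le hM hlsc hβ hconc hmeas hP2 hmhat
  have hint := EWA.integrable_exp_expertLoss hP2
  refine ⟨fun T _ => le_iInf fun q => ?_, ?_⟩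
  · refine le_trans ?_ (EWA.neg_log_integral_exp_le_pacObjective hβ
      (EWA.measurable_expertLoss hlsc z hmeas T) (hint T))
    rw [EReal.coe_le_coe_iff, le_div_iff₀ hβ]
    have h := Real.log_le_log (integral_exp_pos (hint T)) (hmain T)
    rw [Real.log_exp] at h
    linarith
  · intro _ _ _ hπ T _
    obtain ⟨θ, -, hθ⟩ := Finset.exists_mem_eq_inf' Finset.univ_nonempty (EWA.expertLoss ℓ z m T)
    have hK : (0 : ℝ) < Fintype.card Θ := by exact_mod_cast Fintype.card_pos
    have hmass : π.real {θ} = (Fintype.card Θ : ℝ)⁻¹ := by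
      rw [hπ, measureReal_def, ProbabilityTheory.uniformOn_univ, Measure.count_singleton]
      simp
    -- A single term of the mixture, that of a best expert, already gives the bound.
    have h1 : (Fintype.card Θ : ℝ)⁻¹ * Real.exp (-(β * EWA.expertLoss ℓ z m T θ)) ≤
        ∫ ϑ, Real.exp (-(β * EWA.expertLoss ℓ z m T ϑ)) ∂π := by
      rw [integral_fintype (hint T), ← hmass]
      exact Finset.single_le_sum
        (f := fun ϑ => π.real {ϑ} • Real.exp (-(β * EWA.expertLoss ℓ z m T ϑ)))
        (fun ϑ _ => smul_nonneg measureReal_nonneg (Real.exp_pos _).le) (Finset.mem_univ θ)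
    have h2 := Real.log_le_log (by positivity) (h1.trans (hmain T))
    rw [Real.log_exp, Real.log_mul (by positivity) (Real.exp_pos _).ne', Real.log_inv,
      Real.log_exp] at h2
    rw [EWA.regret, hθ, le_div_iff₀ hβ]
    linarith
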